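/- Let $M$ be a finite set of indivisible items. A valuation is a function $v:2^{M}\to\mathbb{R}$ with $v(\emptyset)=0$ and $v(S)\le v(T)$ whenever $S\subseteq T$. It is additive if $v(S)=\sum_{e\in S}v(\{e\})$ for all $S$, subadditive if $v(S\cup T)\le v(S)+v(T)$ for all $S,T$, and XOS if there are finitely many additive valuations $v_1,\dots,v_t$ with $v(S)=\max_j v_j(S)$ for every $S$. For $\rho\in[0,1]$, a fractional $\rho$-partition of $M$ is a finite family of bundles $P_1,\dots,P_k\subseteq M$ with weights $\lambda_1,\dots,\lambda_k\ge 0$ such that $\sum_j\lambda_j=1$ and $\sum_{j:\,e\in P_j}\lambda_j=\rho$ for every $e\in M$. The maximum expectation share $\mathrm{MES}(v,\rho)$ is the maximum of $\sum_j\lambda_j v(P_j)$ over all fractional $\rho$-partitions. For $n\ge 2$, the maximin share $\mathrm{MMS}(v,\tfrac1n)$ is the maximum, over all partitions $(P_1,\dots,P_n)$ of $M$ into $n$ disjoint (possibly empty) sets, of $\min_j v(P_j)$. There are $n$ agents; agent $i$ has a valuation $v_i$ and an entitlement $b_i>0$, where $\sum_i b_i=1$. An allocation is a partition of $M$ into bundles,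 one for each agent; a randomized allocation is a probability distribution over allocations. Theorem. 1. Subadditive valuations. (a) For arbitrary entitlements, if every $v_i$ is subadditive, then there is a randomized allocation in which, for every agent $i$, the expected $v_i$-value of the bundle of agent $i$ is at least $\frac12\,\mathrm{MES}(v_i,b_i)$. (b) For every $\varepsilon>0$ there is an instance with $n\ge 2$ agents with equal entitlements $\frac1n$ and subadditive valuations, with $\mathrm{MMS}(v_i,\frac1n)>0$ for every agent $i$, in which no randomized allocation gives every agent $i$ more than $(\frac12+\varepsilon)\,\mathrm{MMS}(v_i,\frac1n)$ in expectation. 2. XOS valuations. (a) For arbitrary entitlements, if every $v_i$ is XOS, then there is a randomized allocation in which, for every agent $i$, the expected $v_i$-value of the bundle of agent $i$ is at least $(1-\frac1e)\,\mathrm{MES}(v_i,b_i)$. (b) For every $\varepsilon>0$ there is an instance with $n\ge 2$ agents with equal entitlements $\frac1n$ and XOS valuations, with $\mathrm{MMS}(v_i,\frac1n)>0$ for every agent $i$, in which no randomized allocation gives every agent $i$ more than $(1-\frac1e+\varepsilon)\,\mathrm{MMS}(v_i,\frac1n)$ in expectation. -/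

import Mathlib

namespace FairDivision

/-- A valuation over the items `M`: a normalized, monotone real-valued set function. -/
structure IsValuation {M : Type*} (v : Finset M → ℝ) : Prop where
  normalized : v ∅ = 0
  monotone : ∀ S T : Finset M, S ⊆ T → v S ≤ v T

/-- An additive set function: the value of a bundle is the sum of the values of its items. -/
def IsAdditive {M : Type*} (v : Finset M → ℝ) : Prop :=
  ∀ S : Finset M, v S = ∑ e ∈ S, v {e}

/-- A subadditive valuation. -/
structure IsSubadditive {M : Type*} [DecidableEq M] (v : Finset M → ℝ) : Prop where
  isValuation : IsValuation v
  subadditive : ∀ S T : Finset M, v (S ∪ T) ≤ v S + v T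

/-- An XOS valuation: a pointwise maximum of finitely many additive valuations. -/
structure IsXOS {M : Type*} (v : Finset M → ℝ) : Prop where
  isValuation : IsValuation v
  exists_max : ∃ (t : ℕ) (a : Fin t → Finset M → ℝ),
    (∀ j, IsValuation (a j) ∧ IsAdditive (a j)) ∧
      ∀ S : Finset M, IsGreatest (Set.range fun j => a j S) (v S)

/-- `a : M → N` hands each item `e` to exactly one `a e : N`; these functions are in bijection with
the partitions of the items `M` into disjoint, possibly empty sets labelled by `N`.
`bundle a i` is the set with label `i`. -/
def bundle {M N : Type*} [Fintype M] [DecidableEq N] (a : M → N) (i : N) : Finset M :=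
  Finset.univ.filter fun e => a e = i

/-- The bundles `P j` with the weights `w j` form a fractional `ρ`-partition of the items. -/
structure IsFractionalPartition {M : Type*} [DecidableEq M] (ρ : ℝ) {k : ℕ}
    (P : Fin k → Finset M) (w : Fin k → ℝ) : Prop where
  nonneg : ∀ j, 0 ≤ w j
  sum_eq_one : ∑ j, w j = 1
  sum_item : ∀ e : M, ∑ j ∈ Finset.univ.filter (fun j => e ∈ P j), w j = ρ

/-- The expected values of a random bundle drawn from some fractional `ρ`-partition. -/
def mesValues {M : Type*} [DecidableEq M] (v : Finset M → ℝ) (ρ : ℝ) : Set ℝ :=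
  {x | ∃ (k : ℕ) (P : Fin k → Finset M) (w : Fin k → ℝ),
    IsFractionalPartition ρ P w ∧ x = ∑ j, w j * v (P j)}

/-- The maximum expectation share of an agent with valuation `v` and entitlement `ρ`. -/
noncomputable def mes {M : Type*} [DecidableEq M] (v : Finset M → ℝ) (ρ : ℝ) : ℝ :=
  sSup (mesValues v ρ)

theorem mesValues_nonempty {M : Type*} [Fintype M] [DecidableEq M] (v : Finset M → ℝ) {ρ : ℝ}
    (h0 : 0 ≤ ρ) (h1 : ρ ≤ 1) : (mesValues v ρ).Nonempty := by
  refine ⟨_, 2, ![Finset.univ, ∅], ![ρ, 1 - ρ], ⟨?_, ?_, ?_⟩, rfl⟩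
  · intro j
    fin_cases j <;> simp [h0, h1]
  · simp
  · intro e
    rw [Finset.sum_filter]
    simp

theorem mesValues_bddAbove {M : Type*} [Fintype M] [DecidableEq M] {v : Finset M → ℝ}
    (hv : IsValuation v) (ρ : ℝ) : BddAbove (mesValues v ρ) := by
  refine ⟨v Finset.univ, ?_⟩
  rintro x ⟨k, P, w, h, rfl⟩
  calc ∑ j, w j * v (P j) ≤ ∑ j, w j * v Finset.univ :=
        Finset.sum_le_sum fun j _ =>
          mul_le_mul_of_nonneg_left (hv.monotone _ _ (Finset.subset_univ _)) (h.nonneg j)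
    _ = v Finset.univ := by rw [← Finset.sum_mul, h.sum_eq_one, one_mul]

/-- The maximin share of an agent with valuation `v` and entitlement `1 / n`, where `n ≥ 1`: the
maximum over all `n`-partitions (finitely many) of the smallest value of a part. -/
noncomputable def mms {M : Type*} [Fintype M] (v : Finset M → ℝ) (n : ℕ) : ℝ :=
  ⨆ a : M → Fin n, ⨅ j : Fin n, v (bundle a j)

theorem mms_isGreatest {M : Type*} [Fintype M] (v : Finset M → ℝ) (n : ℕ) (hn : 0 < n) :
    IsGreatest (Set.range fun a : M → Fin n => ⨅ j : Fin n, v (bundle a j)) (mms v n) := by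
  classical
  haveI : Nonempty (M → Fin n) := ⟨fun _ => ⟨0, hn⟩⟩
  exact (Set.finite_range _).isCompact.isGreatest_sSup (Set.range_nonempty _)

/-- The expected value of agent `i` under the randomized allocation that chooses the
allocation `a : M → N` with probability `p a`. -/
noncomputable def expectedValue {M N : Type*} [Fintype M] [DecidableEq M] [Fintype N]
    [DecidableEq N] (p : (M → N) → ℝ) (v : Finset M → ℝ) (i : N) : ℝ :=
  ∑ a : M → N, p a * v (bundle a i)

end FairDivision

namespace FairDivision

/-! Guarantees. The expected surplus vectors of randomized allocations form a compact convex set. If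
it missed the nonnegative orthant, a separating functional would give nonnegative weights under
which every allocation has too little welfare. So it suffices to bound weighted welfare
(`exists_randomized_of_welfare`), and both classes of valuations absorb nonnegative weights.

For subadditive valuations the welfare comes from a coarse correlated equilibrium of an all-pay
auction. An agent may draw a bundle from its fractional partition and overbid an independent copy of
the equilibrium's highest bids, which wins half the value in expectation. The expected cost is, up
to grid error, a `b i` fraction of the total price, so the prices cancel on summing over agents
(`IsSubadditive.exists_welfare_ge`).

For XOS valuations, agents draw bundles independently and each item goes to the agent whose
supporting additive function values it most. The loss is the correlation gap of a maximum
(`IsXOS.exists_welfare_ge`).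

Tightness. Items are the points of an `n`-dimensional cube of side `n`, and agent `i` cares about
the slices of coordinate `i`. Slices of different agents always meet, so they cannot all be handed
out intact. -/

/-! ### Duality: from welfare bounds to randomized allocations -/

theorem exists_mem_stdSimplex_forall_nonneg {A I : Type*} [Fintype A] [Fintype I]
    (u : A → I → ℝ)
    (h : ∀ c : I → ℝ, (∀ i, 0 ≤ c i) →
      ∃ p ∈ stdSimplex ℝ A, 0 ≤ ∑ a, p a * ∑ i, c i * u a i) :
    ∃ p ∈ stdSimplex ℝ A, ∀ i, 0 ≤ ∑ a, p a * u a i := by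
  classical
  by_contra! hcon
  let F : (A → ℝ) →ₗ[ℝ] (I → ℝ) := (Matrix.of u).vecMulLinear
  have hF : ∀ p i, F p i = ∑ a, p a * u a i := fun p i => by
    simp [F, Matrix.vecMul, dotProduct]
  have hdisj : Disjoint (F '' stdSimplex ℝ A) (Set.Ici (0 : I → ℝ)) := by
    rw [Set.disjoint_left]
    rintro _ ⟨p, hp, rfl⟩ hy
    obtain ⟨i, hi⟩ := hcon p hp
    have := hy i
    rw [hF] at this
    exact absurd hi (not_lt.2 this)
  obtain ⟨f, s, t, hs, hst, ht⟩ := geometric_hahn_banach_compact_closed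
    ((convex_stdSimplex ℝ A).linear_image F)
    ((isCompact_stdSimplex ℝ A).image F.continuous_of_finiteDimensional)
    (convex_Ici (0 : I → ℝ)) isClosed_Ici hdisj
  have ht0 : t < 0 := by simpa using ht 0 (Set.self_mem_Ici)
  have hf : ∀ y : I → ℝ, f y = ∑ i, f (Pi.single i 1) * y i := fun y => by
    conv_lhs => rw [← Finset.univ_sum_single y, map_sum]
    refine Finset.sum_congr rfl fun i _ => ?_
    rw [mul_comm, ← smul_eq_mul, ← map_smul, ← Pi.single_smul]
    simp
  have hc : ∀ i, 0 ≤ f (Pi.single i 1) := by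
    intro i
    by_contra! hneg
    -- The scaling makes `f` equal to exactly `t` at a point of the orthant, against the strict
    -- separation.
    have := ht ((t / f (Pi.single i 1)) • Pi.single i 1) (by
      rw [Set.mem_Ici]
      exact smul_nonneg (div_nonneg_of_nonpos ht0.le hneg.le) (Pi.single_nonneg.2 zero_le_one))
    rw [map_smul, smul_eq_mul, div_mul_cancel₀ _ hneg.ne] at this
    exact lt_irrefl _ this
  obtain ⟨p, hp, hpos⟩ := h _ hc
  have h1 := hs _ ⟨p, hp, rfl⟩
  have h2 : f (F p) = ∑ a, p a * ∑ i, f (Pi.single i 1) * u a i := by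
    rw [hf]
    simp_rw [hF, Finset.mul_sum]
    rw [Finset.sum_comm]
    exact Finset.sum_congr rfl fun a _ => Finset.sum_congr rfl fun i _ => by ring
  linarith

/-- By duality it is enough to answer each fixed weighting of the regrets. Normalizing the weights
of agent `i` to a mixed strategy and letting all agents play independently makes every agent's
weighted regret vanish, since the deviation then has the same law as the action it replaces. -/
theorem exists_coarse_correlated_equilibrium {N D : Type*} [Fintype N] [DecidableEq N]
    [Fintype D] [Nonempty D] (u : N → (N → D) → ℝ) :
    ∃ μ ∈ stdSimplex ℝ (N → D), ∀ i d,
      ∑ b, μ b * u i (Function.update b i d) ≤ ∑ b, μ b * u i b := by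
  classical
  have key := exists_mem_stdSimplex_forall_nonneg
    (fun (b : N → D) (x : N × D) => u x.1 b - u x.1 (Function.update b x.1 x.2)) ?_
  · obtain ⟨μ, hμ, h⟩ := key
    refine ⟨μ, hμ, fun i d => ?_⟩
    have := h (i, d)
    simp only [mul_sub, Finset.sum_sub_distrib] at this
    linarith
  intro c hc
  have hm : ∀ i, ∃ m : D → ℝ, m ∈ stdSimplex ℝ D ∧ ∀ d, c (i, d) = (∑ d', c (i, d')) * m d := by
    intro i
    rcases (Finset.sum_nonneg fun d' _ => hc (i, d') : 0 ≤ ∑ d', c (i, d')).eq_or_lt with h0 | h0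
    · obtain ⟨d₀⟩ := ‹Nonempty D›
      refine ⟨_, single_mem_stdSimplex ℝ d₀, fun d => ?_⟩
      rw [← h0, zero_mul]
      exact (Finset.sum_eq_zero_iff_of_nonneg fun d' _ => hc (i, d')).1 h0.symm d (Finset.mem_univ _)
    · refine ⟨fun d => c (i, d) / ∑ d', c (i, d'), ⟨fun d => div_nonneg (hc _) h0.le, ?_⟩,
        fun d => (mul_div_cancel₀ _ h0.ne').symm⟩
      rw [← Finset.sum_div, div_self h0.ne']
  choose m hm hcm using hm
  have hsum : ∑ b : N → D, ∏ i, m i (b i) = 1 := by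
    rw [← Fintype.piFinset_univ, ← Finset.prod_univ_sum]
    exact Finset.prod_eq_one fun i _ => (hm i).2
  refine ⟨fun b => ∏ i, m i (b i), ⟨fun b => Finset.prod_nonneg fun i _ => (hm i).1 _, hsum⟩, ?_⟩
  have hre : ∀ i, ∑ d, ∑ b : N → D, m i d * ((∏ j, m j (b j)) * u i (Function.update b i d)) =
      ∑ b : N → D, (∏ j, m j (b j)) * u i b := by
    intro i
    have h1 : ∑ b : N → D, (∏ j, m j (b j)) * u i b =
        ∑ d, ∑ b : N → D, m i d * ((∏ j, m j (b j)) * u i b) := by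
      simp_rw [← Finset.mul_sum]
      rw [← Finset.sum_mul, (hm i).2, one_mul]
    rw [h1, ← Finset.sum_product', ← Finset.sum_product']
    -- Exchanging the played action with the deviation is an involution that preserves the product
    -- weight.
    refine Finset.sum_nbij' (fun x => (x.2 i, Function.update x.2 i x.1))
      (fun x => (x.2 i, Function.update x.2 i x.1)) (by simp) (by simp) (by simp) (by simp) ?_
    rintro ⟨d, b⟩ -
    have h2 : m i d * ∏ j, m j (b j) = m i (b i) * ∏ j, m j (Function.update b i d j) := by
      rw [← Finset.mul_prod_erase _ _ (Finset.mem_univ i),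
        ← Finset.mul_prod_erase Finset.univ (fun j => m j (Function.update b i d j))
          (Finset.mem_univ i), Function.update_self, mul_left_comm]
      congr 2
      refine Finset.prod_congr rfl fun j hj => ?_
      rw [Function.update_of_ne (Finset.ne_of_mem_erase hj)]
    simp only
    rw [← mul_assoc, h2, mul_assoc]
  have hzero : ∀ i, ∑ b : N → D, (∏ j, m j (b j)) *
      ∑ d, m i d * (u i b - u i (Function.update b i d)) = 0 := by
    intro i
    have h1 : ∀ b : N → D, (∏ j, m j (b j)) * ∑ d, m i d * (u i b - u i (Function.update b i d)) =
        (∏ j, m j (b j)) * u i b -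
          ∑ d, m i d * ((∏ j, m j (b j)) * u i (Function.update b i d)) := by
      intro b
      simp_rw [mul_sub, Finset.sum_sub_distrib]
      rw [← Finset.sum_mul, (hm i).2, one_mul, mul_sub, Finset.mul_sum]
      congr 1
      exact Finset.sum_congr rfl fun d _ => by ring
    simp_rw [h1, Finset.sum_sub_distrib]
    rw [Finset.sum_comm, hre, sub_self]
  refine le_of_eq ?_
  have h3 : ∀ b : N → D, (∏ j, m j (b j)) * ∑ x : N × D, c x *
      (u x.1 b - u x.1 (Function.update b x.1 x.2)) =
      ∑ i, (∑ d', c (i, d')) * ((∏ j, m j (b j)) *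
        ∑ d, m i d * (u i b - u i (Function.update b i d))) := by
    intro b
    rw [Fintype.sum_prod_type, Finset.mul_sum]
    refine Finset.sum_congr rfl fun i _ => ?_
    rw [mul_left_comm, Finset.mul_sum _ _ (∑ d', c (i, d'))]
    congr 1
    refine Finset.sum_congr rfl fun d _ => ?_
    rw [← mul_assoc, ← hcm]
  simp_rw [h3]
  rw [Finset.sum_comm]
  simp_rw [← Finset.mul_sum, hzero, mul_zero, Finset.sum_const_zero]

theorem exists_randomized_of_welfare {N M : Type*} [Fintype N] [DecidableEq N] [Fintype M]
    [DecidableEq M] {b : N → ℝ} {v : N → Finset M → ℝ} {κ : ℝ} (hκ : 0 ≤ κ)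
    (hb : ∀ i, 0 < b i) (hb1 : ∑ i, b i = 1)
    (h : ∀ c : N → ℝ, (∀ i, 0 ≤ c i) → ∀ x : N → ℝ, (∀ i, x i ∈ mesValues (v i) (b i)) →
      ∀ ε, 0 < ε → ∃ a : M → N, κ * ∑ i, c i * x i - ε ≤ ∑ i, c i * v i (bundle a i)) :
    ∃ p ∈ stdSimplex ℝ (M → N), ∀ i, κ * mes (v i) (b i) ≤ expectedValue p (v i) i := by
  have hne : Nonempty N := by
    by_contra hN
    rw [not_nonempty_iff] at hN
    simp at hb1
  have key := exists_mem_stdSimplex_forall_nonneg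
    (fun (a : M → N) (i : N) => v i (bundle a i) - κ * mes (v i) (b i)) ?_
  · obtain ⟨p, hp, hpi⟩ := key
    refine ⟨p, hp, fun i => ?_⟩
    have := hpi i
    simp only [mul_sub, Finset.sum_sub_distrib] at this
    rw [← Finset.sum_mul, hp.2, one_mul] at this
    exact sub_nonneg.1 this
  intro c hc
  obtain ⟨a, ha⟩ := Finite.exists_max fun a : M → N => ∑ i, c i * v i (bundle a i)
  refine ⟨_, single_mem_stdSimplex ℝ a, ?_⟩
  suffices hsuff : ∀ ε, 0 < ε →
      κ * ∑ i, c i * mes (v i) (b i) - ε ≤ ∑ i, c i * v i (bundle a i) by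
    have := le_of_forall_sub_le hsuff
    rw [Finset.sum_eq_single a (fun a' _ h' => by simp [h']) (by simp), Pi.single_eq_same, one_mul]
    simp_rw [mul_sub, Finset.sum_sub_distrib]
    rw [Finset.mul_sum] at this
    simp_rw [mul_left_comm (c _) κ]
    linarith
  intro ε hε
  have hC : 0 ≤ κ * ∑ i, c i := mul_nonneg hκ (Finset.sum_nonneg fun i _ => hc i)
  -- Approximants of the supremum within `η` cost at most `ε / 2` of welfare; the `+ 1` keeps the
  -- denominator positive.
  set η : ℝ := ε / 2 / (κ * ∑ i, c i + 1) with hη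
  have hηpos : 0 < η := by positivity
  have hηle : κ * ∑ i, c i * η ≤ ε / 2 := by
    rw [← Finset.sum_mul, ← mul_assoc]
    have : (κ * ∑ i, c i + 1) * η = ε / 2 := mul_div_cancel₀ _ (by positivity)
    linarith
  have hx : ∀ i, ∃ x ∈ mesValues (v i) (b i), mes (v i) (b i) - η < x := fun i =>
    exists_lt_of_lt_csSup (mesValues_nonempty _ (hb i).le
      (hb1 ▸ Finset.single_le_sum (fun j _ => (hb j).le) (Finset.mem_univ i)))
      (sub_lt_self _ hηpos)
  choose x hx hlt using hx
  obtain ⟨a', ha'⟩ := h c hc x hx (ε / 2) (by positivity)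
  refine le_trans ?_ (ha a')
  have : κ * ∑ i, c i * mes (v i) (b i) ≤ κ * ∑ i, c i * x i + κ * ∑ i, c i * η := by
    rw [← mul_add, ← Finset.sum_add_distrib]
    refine mul_le_mul_of_nonneg_left (Finset.sum_le_sum fun i _ => ?_) hκ
    rw [← mul_add]
    exact mul_le_mul_of_nonneg_left (by linarith [hlt i]) (hc i)
  linarith

/-! ### Subadditive valuations: equilibrium of an all-pay auction -/

theorem IsFractionalPartition.sum_mul_sum {M : Type*} [Fintype M] [DecidableEq M] {ρ : ℝ} {k : ℕ}
    {P : Fin k → Finset M} {w : Fin k → ℝ} (h : IsFractionalPartition ρ P w) (g : M → ℝ) :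
    ∑ j, w j * ∑ e ∈ P j, g e = ρ * ∑ e, g e := by
  calc ∑ j, w j * ∑ e ∈ P j, g e = ∑ j, ∑ e, if e ∈ P j then w j * g e else 0 := by
        simp_rw [Finset.sum_ite_mem, Finset.univ_inter, Finset.mul_sum]
    _ = ∑ e, ρ * g e := by
        rw [Finset.sum_comm]
        refine Finset.sum_congr rfl fun e _ => ?_
        rw [← Finset.sum_filter, ← Finset.sum_mul, h.sum_item]
    _ = ρ * ∑ e, g e := (Finset.mul_sum _ _ _).symm

theorem IsSubadditive.exists_welfare_ge {N M : Type*} [Fintype N] [DecidableEq N] [Fintype M]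
    [DecidableEq M] {v : N → Finset M → ℝ} (hv : ∀ i, IsSubadditive (v i)) {b : N → ℝ}
    (hb1 : ∑ i, b i = 1) {k : N → ℕ} {P : ∀ i, Fin (k i) → Finset M} {w : ∀ i, Fin (k i) → ℝ}
    (hP : ∀ i, IsFractionalPartition (b i) (P i) (w i)) {ε : ℝ} (hε : 0 < ε) :
    ∃ a : M → N, 1 / 2 * ∑ i, ∑ j, w i j * v i (P i j) - ε ≤ ∑ i, v i (bundle a i) := by
  classical
  have hne : Nonempty N := by
    by_contra hN
    rw [not_nonempty_iff] at hN
    simp at hb1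
  have hv0 : ∀ i S, 0 ≤ v i S := fun i S =>
    (hv i).isValuation.normalized ▸ (hv i).isValuation.monotone _ _ (Finset.empty_subset S)
  have hmono : ∀ i S T, S ⊆ T → v i S ≤ v i T := fun i => (hv i).isValuation.monotone
  -- the winner of every item in the auction
  have halloc : ∀ (β : N → M → ℕ) (e : M), ∃ i, ∀ j, β j e ≤ β i e := fun β e =>
    Finite.exists_max fun i => β i e
  choose alloc halloc using halloc
  have hwin : ∀ (β : N → M → ℕ) (i : N) (d : M → ℕ) (e : M), (∀ j, β j e < d e) →
      alloc (Function.update β i d) e = i := by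
    intro β i d e h
    by_contra hcon
    have h1 := halloc (Function.update β i d) e i
    rw [Function.update_self, Function.update_of_ne hcon] at h1
    exact absurd (h (alloc (Function.update β i d) e)) (not_lt.2 h1)
  set δ : ℝ := ε / (Fintype.card M + 1) with hδ
  have hδpos : 0 < δ := by positivity
  have hδle : δ * Fintype.card M ≤ ε := by
    have : δ * (Fintype.card M + 1) = ε := div_mul_cancel₀ _ (by positivity)
    linarith
  -- Bids are multiples of `δ` and are paid whether or not the item is won, so the cost of a
  -- deviation does not depend on the other bids.
  let U : N → (N → M → ℕ) → ℝ := fun i β =>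
    v i (bundle (alloc β) i) - δ * ∑ e, (β i e : ℝ)
  -- A bid above `K` on one item already costs at least the value of everything, so bidding zero is
  -- no worse; capping bids at `K` thus excludes no useful deviation.
  obtain ⟨K, hK⟩ := exists_nat_ge ((∑ i, v i Finset.univ) / δ)
  rw [div_le_iff₀ hδpos] at hK
  let up : (M → Fin (K + 1)) → M → ℕ := fun d e => d e
  obtain ⟨μ, hμ, hcce⟩ := exists_coarse_correlated_equilibrium
    (fun i (β : N → M → Fin (K + 1)) => U i (fun j => up (β j)))
  have hupd : ∀ (β : N → M → Fin (K + 1)) i d,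
      (fun j => up (Function.update β i d j)) = Function.update (fun j => up (β j)) i (up d) := by
    intro β i d
    funext j
    by_cases hj : j = i
    · subst hj; simp
    · simp [hj]
  let EU : N → ℝ := fun i => ∑ β, μ β * U i (fun j => up (β j))
  have hdev : ∀ i (d : M → ℕ),
      ∑ β, μ β * U i (Function.update (fun j => up (β j)) i d) ≤ EU i := by
    intro i d
    by_cases hd : ∀ e, d e < K + 1
    · have h1 := hcce i (fun e => ⟨d e, hd e⟩)
      simp only [hupd] at h1
      exact h1
    · push Not at hd
      obtain ⟨e, he⟩ := hd
      have h1 := hcce i (fun _ => 0)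
      simp only [hupd] at h1
      refine le_trans (Finset.sum_le_sum fun β _ => ?_) h1
      refine mul_le_mul_of_nonneg_left ?_ (hμ.1 β)
      simp only [U, Function.update_self]
      have h2 : (K : ℝ) ≤ ∑ e, (d e : ℝ) := by
        refine le_trans ?_ (Finset.single_le_sum (f := fun e => (d e : ℝ))
          (fun e _ => Nat.cast_nonneg _) (Finset.mem_univ e))
        exact_mod_cast (Nat.le_succ K).trans he
      have h3 := mul_le_mul_of_nonneg_left h2 hδpos.le
      have h4 : v i (bundle (alloc (Function.update (fun j => up (β j)) i d)) i) ≤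
          ∑ i, v i Finset.univ := (hmono i _ _ (Finset.subset_univ _)).trans
        (Finset.single_le_sum (f := fun i => v i Finset.univ) (fun i _ => hv0 i _)
          (Finset.mem_univ i))
      have h5 := hv0 i (bundle (alloc (Function.update (fun j => up (β j)) i (up fun _ => 0))) i)
      have h6 : ∑ e, ((up (fun _ => 0) e : ℕ) : ℝ) = 0 := by simp [up]
      rw [h6]
      linarith
  -- the highest bid on every item
  let R : (N → M → Fin (K + 1)) → M → ℕ := fun β e => Finset.univ.sup fun j => up (β j) e
  have hR : ∀ β j e, up (β j) e ≤ R β e := fun β j e =>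
    Finset.le_sup (f := fun j => up (β j) e) (Finset.mem_univ j)
  -- The `+ 1` wins the item even when the sampled and the actual highest bids tie; in total it
  -- costs at most `δ * Fintype.card M ≤ ε`.
  let bid : Finset M → (N → M → Fin (K + 1)) → M → ℕ := fun S β e =>
    if e ∈ S then R β e + 1 else 0
  have hval : ∀ i S β β', v i (S.filter fun e => R β e ≤ R β' e) ≤
      v i (bundle (alloc (Function.update (fun j => up (β j)) i (bid S β'))) i) := by
    intro i S β β'
    refine hmono i _ _ fun e he => ?_
    rw [Finset.mem_filter] at he
    simp only [bundle, Finset.mem_filter, Finset.mem_univ, true_and]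
    refine hwin _ _ _ _ fun j => ?_
    simp only [bid, if_pos he.1]
    exact Nat.lt_succ_of_le ((hR β j e).trans he.2)
  -- Swapping the two independent copies preserves the sum, while the items with `R β e ≤ R β' e`
  -- and those with `R β' e ≤ R β e` together cover `S`; subadditivity gives one of the two equal
  -- sums half of the value.
  have hhalf : ∀ i S, 1 / 2 * v i S ≤
      ∑ β', ∑ β, μ β' * (μ β * v i (S.filter fun e => R β e ≤ R β' e)) := by
    intro i S
    have h1 : ∑ β', ∑ β, μ β' * (μ β * v i (S.filter fun e => R β e ≤ R β' e)) =
        ∑ β', ∑ β, μ β' * (μ β * v i (S.filter fun e => R β' e ≤ R β e)) := by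
      rw [Finset.sum_comm]
      exact Finset.sum_congr rfl fun β _ => Finset.sum_congr rfl fun β' _ => by ring
    have h2 : v i S = ∑ β', ∑ β, μ β' * (μ β * v i S) := by
      simp_rw [← Finset.mul_sum, ← Finset.sum_mul, hμ.2, one_mul]
    have h3 : v i S ≤ ∑ β', ∑ β, μ β' * (μ β * v i (S.filter fun e => R β e ≤ R β' e)) +
        ∑ β', ∑ β, μ β' * (μ β * v i (S.filter fun e => R β' e ≤ R β e)) := by
      rw [h2]
      simp_rw [← Finset.sum_add_distrib, ← mul_add]
      refine Finset.sum_le_sum fun β' _ => Finset.sum_le_sum fun β _ => ?_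
      refine mul_le_mul_of_nonneg_left (mul_le_mul_of_nonneg_left ?_ (hμ.1 _)) (hμ.1 _)
      refine le_trans (hmono i _ _ fun e he => ?_) ((hv i).subadditive _ _)
      simp only [Finset.mem_union, Finset.mem_filter, he, true_and]
      exact le_total _ _
    linarith
  let ER : M → ℝ := fun e => ∑ β, μ β * R β e
  have hcost : ∀ S, ∑ β', μ β' * (δ * ∑ e, (bid S β' e : ℝ)) = δ * ∑ e ∈ S, (ER e + 1) := by
    intro S
    have h1 : ∀ β', ∑ e, (bid S β' e : ℝ) = ∑ e ∈ S, ((R β' e : ℝ) + 1) := by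
      intro β'
      rw [← Finset.univ_inter S, ← Finset.sum_ite_mem]
      refine Finset.sum_congr rfl fun e _ => ?_
      simp only [bid, Finset.univ_inter]
      split_ifs <;> simp
    simp_rw [h1, mul_left_comm _ δ, ← Finset.mul_sum]
    congr 1
    simp_rw [Finset.mul_sum]
    rw [Finset.sum_comm]
    refine Finset.sum_congr rfl fun e _ => ?_
    simp_rw [mul_add, Finset.sum_add_distrib, mul_one, hμ.2]
    rfl
  have hS : ∀ i S, 1 / 2 * v i S - δ * ∑ e ∈ S, (ER e + 1) ≤ EU i := by
    intro i S
    have h1 : ∑ β', μ β' * ∑ β, μ β * U i (Function.update (fun j => up (β j)) i (bid S β')) ≤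
        EU i := by
      calc _ ≤ ∑ β', μ β' * EU i := Finset.sum_le_sum fun β' _ =>
            mul_le_mul_of_nonneg_left (hdev i _) (hμ.1 _)
        _ = EU i := by rw [← Finset.sum_mul, hμ.2, one_mul]
    refine le_trans ?_ h1
    have h2 : ∀ β', ∑ β, μ β * v i (S.filter fun e => R β e ≤ R β' e) -
        δ * ∑ e, (bid S β' e : ℝ) ≤
        ∑ β, μ β * U i (Function.update (fun j => up (β j)) i (bid S β')) := by
      intro β'
      simp only [U, Function.update_self, mul_sub, Finset.sum_sub_distrib]
      rw [← Finset.sum_mul, hμ.2, one_mul]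
      exact sub_le_sub_right (Finset.sum_le_sum fun β _ =>
        mul_le_mul_of_nonneg_left (hval i S β β') (hμ.1 _)) _
    refine le_trans ?_ (Finset.sum_le_sum fun β' _ =>
      mul_le_mul_of_nonneg_left (h2 β') (hμ.1 β'))
    simp_rw [mul_sub, Finset.sum_sub_distrib, Finset.mul_sum Finset.univ _ (μ _)]
    have h3 := hcost S
    simp_rw [Finset.mul_sum Finset.univ _ δ, Finset.mul_sum Finset.univ _ (μ _)] at h3
    simp_rw [Finset.mul_sum Finset.univ _ δ, Finset.mul_sum Finset.univ _ (μ _)]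
    rw [h3]
    exact sub_le_sub_right (hhalf i S) _
  have hi : ∀ i, 1 / 2 * ∑ j, w i j * v i (P i j) - δ * (b i * ∑ e, (ER e + 1)) ≤ EU i := by
    intro i
    calc _ = ∑ j, w i j * (1 / 2 * v i (P i j) - δ * ∑ e ∈ P i j, (ER e + 1)) := by
          rw [← (hP i).sum_mul_sum, Finset.mul_sum, Finset.mul_sum, ← Finset.sum_sub_distrib]
          exact Finset.sum_congr rfl fun j _ => by ring
      _ ≤ ∑ j, w i j * EU i := Finset.sum_le_sum fun j _ =>
          mul_le_mul_of_nonneg_left (hS i _) ((hP i).nonneg j)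
      _ = EU i := by rw [← Finset.sum_mul, (hP i).sum_eq_one, one_mul]
  have hlow : 1 / 2 * ∑ i, ∑ j, w i j * v i (P i j) - δ * ∑ e, ER e - ε ≤ ∑ i, EU i := by
    have h1 := Finset.sum_le_sum fun i (_ : i ∈ Finset.univ) => hi i
    rw [Finset.sum_sub_distrib, ← Finset.mul_sum, ← Finset.mul_sum, ← Finset.sum_mul, hb1, one_mul,
      Finset.sum_add_distrib, mul_add] at h1
    simp only [Finset.sum_const, Finset.card_univ, nsmul_eq_mul, mul_one] at h1
    linarith
  -- Since all bids are paid, the payments for each item are at least its highest bid; this is what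
  -- cancels the prices in `hlow`.
  have hup : ∑ i, EU i ≤ ∑ β, μ β * ∑ i, v i (bundle (alloc fun j => up (β j)) i) -
      δ * ∑ e, ER e := by
    have h1 : δ * ∑ e, ER e = ∑ β, μ β * (δ * ∑ e, (R β e : ℝ)) := by
      simp_rw [mul_left_comm _ δ, ← Finset.mul_sum]
      congr 1
      simp only [ER]
      rw [Finset.sum_comm]
      simp_rw [Finset.mul_sum]
    rw [h1, ← Finset.sum_sub_distrib, Finset.sum_comm]
    refine Finset.sum_le_sum fun β _ => ?_
    rw [← Finset.mul_sum, ← mul_sub]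
    refine mul_le_mul_of_nonneg_left ?_ (hμ.1 _)
    simp only [U]
    rw [Finset.sum_sub_distrib, ← Finset.mul_sum, Finset.sum_comm]
    refine sub_le_sub_left (mul_le_mul_of_nonneg_left (Finset.sum_le_sum fun e _ => ?_) hδpos.le) _
    obtain ⟨j, -, hj⟩ := Finset.exists_mem_eq_sup Finset.univ Finset.univ_nonempty
      (fun j => up (β j) e)
    have h2 : R β e = up (β j) e := hj
    rw [h2]
    exact Finset.single_le_sum (f := fun j => ((up (β j) e : ℕ) : ℝ))
      (fun _ _ => Nat.cast_nonneg _) (Finset.mem_univ j)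
  by_contra! hcon
  have hlt : ∑ β, μ β * ∑ i, v i (bundle (alloc fun j => up (β j)) i) <
      1 / 2 * ∑ i, ∑ j, w i j * v i (P i j) - ε := by
    obtain ⟨a, ha⟩ := Finite.exists_max fun a : M → N => ∑ i, v i (bundle a i)
    refine lt_of_le_of_lt ?_ (hcon a)
    calc _ ≤ ∑ β, μ β * ∑ i, v i (bundle a i) := Finset.sum_le_sum fun β _ =>
          mul_le_mul_of_nonneg_left (ha _) (hμ.1 _)
      _ = _ := by rw [← Finset.sum_mul, hμ.2, one_mul]
  linarith

theorem IsSubadditive.exists_half_mes {N M : Type*} [Fintype N] [DecidableEq N] [Fintype M]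
    [DecidableEq M] {b : N → ℝ} {v : N → Finset M → ℝ} (hb : ∀ i, 0 < b i) (hb1 : ∑ i, b i = 1)
    (hv : ∀ i, IsSubadditive (v i)) :
    ∃ p ∈ stdSimplex ℝ (M → N), ∀ i, 1 / 2 * mes (v i) (b i) ≤ expectedValue p (v i) i := by
  refine exists_randomized_of_welfare (by norm_num) hb hb1 fun c hc x hx ε hε => ?_
  choose k P w hP hx using hx
  have hcv : ∀ i, IsSubadditive fun S => c i * v i S := fun i =>
    ⟨⟨by simp [(hv i).isValuation.normalized], fun S T h =>
      mul_le_mul_of_nonneg_left ((hv i).isValuation.monotone S T h) (hc i)⟩, fun S T => by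
      rw [← mul_add]
      exact mul_le_mul_of_nonneg_left ((hv i).subadditive S T) (hc i)⟩
  obtain ⟨a, ha⟩ := IsSubadditive.exists_welfare_ge hcv hb1 hP hε
  refine ⟨a, ?_⟩
  simpa only [hx, Finset.mul_sum, mul_left_comm] using ha

/-! ### XOS valuations: independent draws and the correlation gap -/

/-- The convex exponential lies below its chord on `[-1, 0]`. -/
theorem one_sub_inv_exp_mul_le {s : ℝ} (h0 : 0 ≤ s) (h1 : s ≤ 1) :
    (1 - 1 / Real.exp 1) * s ≤ 1 - Real.exp (-s) := by
  have h := convexOn_exp.2 (Set.mem_univ (0 : ℝ)) (Set.mem_univ (-1 : ℝ)) (sub_nonneg.2 h1) h0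
    (by ring)
  simp only [smul_eq_mul, mul_zero, zero_add, Real.exp_zero, mul_one, mul_neg] at h
  rw [one_div, ← Real.exp_neg]
  linarith

theorem integral_indicator_lt {B x : ℝ} (h0 : 0 ≤ x) (hB : x ≤ B) :
    ∫ t in (0 : ℝ)..B, (if t < x then (1 : ℝ) else 0) = x := by
  have h : (fun t : ℝ => if t < x then (1 : ℝ) else 0) =
      Set.indicator (Set.Iio x) (fun _ => 1) := by
    funext t
    simp [Set.indicator]
  rw [intervalIntegral.integral_of_le (h0.trans hB), h,
    MeasureTheory.integral_indicator measurableSet_Iio, MeasureTheory.setIntegral_const, smul_eq_mul,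
    mul_one, MeasureTheory.measureReal_restrict_apply measurableSet_Iio]
  have h2 : Set.Ioo 0 x ⊆ Set.Iio x ∩ Set.Ioc 0 B := fun t ht => ⟨ht.2, ht.1, ht.2.le.trans hB⟩
  have h3 : Set.Iio x ∩ Set.Ioc 0 B ⊆ Set.Ioo 0 x := fun t ht => ⟨ht.2.1, ht.1⟩
  rw [h3.antisymm h2, Real.volume_real_Ioo_of_le h0, sub_zero]

theorem intervalIntegrable_indicator_lt (B x : ℝ) :
    IntervalIntegrable (fun t : ℝ => if t < x then (1 : ℝ) else 0) MeasureTheory.volume 0 B := by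
  refine Antitone.intervalIntegrable fun s t hst => ?_
  split_ifs with h1 h2
  · exact le_rfl
  · exact absurd (hst.trans_lt h1) h2
  · exact zero_le_one
  · exact le_rfl

theorem intervalIntegrable_fintype_sum {ι : Type*} [Fintype ι] {f : ι → ℝ → ℝ} {a b : ℝ}
    (h : ∀ i, IntervalIntegrable (f i) MeasureTheory.volume a b) :
    IntervalIntegrable (fun t => ∑ i, f i t) MeasureTheory.volume a b := by
  rw [← Finset.sum_fn]
  exact IntervalIntegrable.sum Finset.univ fun i _ => h i

/-- The correlation gap of the maximum of independent nonnegative random variables whose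
probabilities of being nonzero sum up to at most one. -/
theorem one_sub_inv_exp_mul_sum_le_sum_sup {N : Type*} [Fintype N] [DecidableEq N] [Nonempty N]
    {k : N → ℕ} {w X : ∀ i, Fin (k i) → ℝ} (hw : ∀ i j, 0 ≤ w i j) (hw1 : ∀ i, ∑ j, w i j = 1)
    (hX : ∀ i j, 0 ≤ X i j) (hs : ∑ i, ∑ j ∈ Finset.univ.filter (fun j => 0 < X i j), w i j ≤ 1)
    {Y : (∀ i, Fin (k i)) → ℝ} (hY : ∀ ω i, X i (ω i) ≤ Y ω) :
    (1 - 1 / Real.exp 1) * ∑ i, ∑ j, w i j * X i j ≤ ∑ ω, (∏ i, w i (ω i)) * Y ω := by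
  obtain ⟨i₀⟩ := ‹Nonempty N›
  have hY0 : ∀ ω, 0 ≤ Y ω := fun ω => (hX i₀ _).trans (hY ω i₀)
  set B : ℝ := ∑ i, ∑ j, X i j + ∑ ω, Y ω
  have hXB : ∀ i j, X i j ≤ B := fun i j =>
    ((Finset.single_le_sum (fun j _ => hX i j) (Finset.mem_univ j)).trans
      (Finset.single_le_sum (f := fun i => ∑ j, X i j)
        (fun i _ => Finset.sum_nonneg fun j _ => hX i j) (Finset.mem_univ i))).trans
      (le_add_of_nonneg_right (Finset.sum_nonneg fun ω _ => hY0 ω))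
  have hYB : ∀ ω, Y ω ≤ B := fun ω =>
    (Finset.single_le_sum (fun ω _ => hY0 ω) (Finset.mem_univ ω)).trans
      (le_add_of_nonneg_left (Finset.sum_nonneg fun i _ => Finset.sum_nonneg fun j _ => hX i j))
  let χ : ℝ → ℝ → ℝ := fun x t => if t < x then 1 else 0
  have hχ : ∀ x, IntervalIntegrable (χ x) MeasureTheory.volume 0 B := fun x =>
    intervalIntegrable_indicator_lt B x
  -- Layer-cake: at level `t` there are independent events of probabilities `q i` with sum at most
  -- one. None occurs with probability `∏ (1 - q i) ≤ exp (-∑ q i)`, and the chord bound applies.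
  -- Integrating over `t` recovers the expectations.
  have hpt : ∀ t, 0 ≤ t → (1 - 1 / Real.exp 1) * ∑ i, ∑ j, w i j * χ (X i j) t ≤
      ∑ ω : ∀ i, Fin (k i), (∏ i, w i (ω i)) * χ (Y ω) t := by
    intro t ht
    have hq0 : ∀ i, 0 ≤ ∑ j, w i j * χ (X i j) t := fun i => Finset.sum_nonneg fun j _ =>
      mul_nonneg (hw i j) (by simp only [χ]; split_ifs <;> norm_num)
    have hq1 : ∑ i, ∑ j, w i j * χ (X i j) t ≤ 1 := by
      refine le_trans (Finset.sum_le_sum fun i _ => ?_) hs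
      rw [Finset.sum_filter]
      refine Finset.sum_le_sum fun j _ => ?_
      simp only [χ, mul_ite, mul_one, mul_zero]
      split_ifs with h1 h2
      · exact le_rfl
      · exact absurd (ht.trans_lt h1) h2
      · exact hw i j
      · exact le_rfl
    refine (one_sub_inv_exp_mul_le (Finset.sum_nonneg fun i _ => hq0 i) hq1).trans ?_
    have hprod : ∑ ω : ∀ i, Fin (k i), ∏ i, (w i (ω i) * (1 - χ (X i (ω i)) t)) =
        ∏ i, (1 - ∑ j, w i j * χ (X i j) t) := by
      rw [← Fintype.piFinset_univ,
        ← Finset.prod_univ_sum (fun i => Finset.univ) (fun i j => w i j * (1 - χ (X i j) t))]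
      refine Finset.prod_congr rfl fun i _ => ?_
      simp_rw [mul_sub, mul_one, Finset.sum_sub_distrib, hw1]
    have hsum : ∑ ω : ∀ i, Fin (k i), ∏ i, w i (ω i) = 1 := by
      rw [← Fintype.piFinset_univ, ← Finset.prod_univ_sum]
      exact Finset.prod_eq_one fun i _ => hw1 i
    have hexp : ∏ i, (1 - ∑ j, w i j * χ (X i j) t) ≤
        Real.exp (-∑ i, ∑ j, w i j * χ (X i j) t) := by
      rw [← Finset.sum_neg_distrib, Real.exp_sum]
      refine Finset.prod_le_prod (fun i _ => ?_) fun i _ => ?_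
      · exact sub_nonneg.2 ((Finset.single_le_sum (fun i _ => hq0 i) (Finset.mem_univ i)).trans hq1)
      · linarith [Real.add_one_le_exp (-∑ j, w i j * χ (X i j) t)]
    have hcompl : 1 - ∑ ω : ∀ i, Fin (k i), (∏ i, w i (ω i)) * χ (Y ω) t ≤
        ∑ ω : ∀ i, Fin (k i), ∏ i, (w i (ω i) * (1 - χ (X i (ω i)) t)) := by
      calc _ = ∑ ω : ∀ i, Fin (k i), (∏ i, w i (ω i)) * (1 - χ (Y ω) t) := by
            simp_rw [mul_one_sub, Finset.sum_sub_distrib, hsum]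
        _ ≤ _ := Finset.sum_le_sum fun ω _ => ?_
      rw [Finset.prod_mul_distrib]
      refine mul_le_mul_of_nonneg_left ?_ (Finset.prod_nonneg fun i _ => hw i _)
      by_cases h1 : t < Y ω
      · simp only [χ, if_pos h1, sub_self]
        refine Finset.prod_nonneg fun i _ => ?_
        split_ifs <;> norm_num
      · rw [Finset.prod_eq_one]
        · simp [χ, h1]
        · intro i _
          simp [χ, not_lt.2 ((hY ω i).trans (not_lt.1 h1))]
    linarith
  have hXint : ∀ i j, X i j = ∫ t in (0 : ℝ)..B, χ (X i j) t := fun i j =>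
    (integral_indicator_lt (hX i j) (hXB i j)).symm
  have hYint : ∀ ω, Y ω = ∫ t in (0 : ℝ)..B, χ (Y ω) t := fun ω =>
    (integral_indicator_lt (hY0 ω) (hYB ω)).symm
  have hint : ∀ i, IntervalIntegrable (fun t => ∑ j, w i j * χ (X i j) t)
      MeasureTheory.volume 0 B := fun i => 
    intervalIntegrable_fintype_sum fun j => (hχ (X i j)).const_mul (w i j)
  have hl : (1 - 1 / Real.exp 1) * ∑ i, ∑ j, w i j * X i j =
      ∫ t in (0 : ℝ)..B, (1 - 1 / Real.exp 1) * ∑ i, ∑ j, w i j * χ (X i j) t := by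
    rw [intervalIntegral.integral_const_mul, intervalIntegral.integral_finsetSum fun i _ =>
      hint i]
    congr 1
    refine Finset.sum_congr rfl fun i _ => ?_
    rw [intervalIntegral.integral_finsetSum fun j _ => (hχ _).const_mul _]
    refine Finset.sum_congr rfl fun j _ => ?_
    rw [intervalIntegral.integral_const_mul, ← hXint]
  have hr : ∑ ω : ∀ i, Fin (k i), (∏ i, w i (ω i)) * Y ω =
      ∫ t in (0 : ℝ)..B, ∑ ω : ∀ i, Fin (k i), (∏ i, w i (ω i)) * χ (Y ω) t := by
    rw [intervalIntegral.integral_finsetSum fun ω _ => (hχ _).const_mul _]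
    refine Finset.sum_congr rfl fun ω _ => ?_
    rw [intervalIntegral.integral_const_mul, ← hYint]
  rw [hl, hr]
  exact intervalIntegral.integral_mono_on
    (add_nonneg (Finset.sum_nonneg fun i _ => Finset.sum_nonneg fun j _ => hX i j)
      (Finset.sum_nonneg fun ω _ => hY0 ω))
    (IntervalIntegrable.const_mul
      (intervalIntegrable_fintype_sum fun i => hint i)
      _)
    (intervalIntegrable_fintype_sum fun ω =>
      (hχ (Y ω)).const_mul (∏ i, w i (ω i)))
    fun t ht => hpt t ht.1

theorem IsXOS.exists_welfare_ge {N M : Type*} [Fintype N] [DecidableEq N] [Fintype M]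
    [DecidableEq M] {v : N → Finset M → ℝ} (hv : ∀ i, IsXOS (v i)) {b : N → ℝ}
    (hb1 : ∑ i, b i = 1) {k : N → ℕ} {P : ∀ i, Fin (k i) → Finset M} {w : ∀ i, Fin (k i) → ℝ}
    (hP : ∀ i, IsFractionalPartition (b i) (P i) (w i)) :
    ∃ a : M → N, (1 - 1 / Real.exp 1) * ∑ i, ∑ j, w i j * v i (P i j) ≤
      ∑ i, v i (bundle a i) := by
  classical
  have hne : Nonempty N := by
    by_contra hN
    rw [not_nonempty_iff] at hN
    simp at hb1
  have hadd : ∀ i j, ∃ g : M → ℝ, (∀ e, 0 ≤ g e) ∧ v i (P i j) = ∑ e ∈ P i j, g e ∧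
      ∀ S, ∑ e ∈ S, g e ≤ v i S := by
    intro i j
    obtain ⟨t, a, ha, hmax⟩ := (hv i).exists_max
    obtain ⟨l, hl⟩ := (hmax (P i j)).1
    refine ⟨fun e => a l {e}, fun e => ?_, ?_, fun S => ?_⟩
    · rw [← (ha l).1.normalized]
      exact (ha l).1.monotone _ _ (Finset.empty_subset _)
    · rw [← hl]
      exact (ha l).2 _
    · rw [← (ha l).2]
      exact (hmax S).2 ⟨l, rfl⟩
  choose g hg0 hgP hgS using hadd
  -- Contribution of an item through the additive function supporting the drawn bundle. It is
  -- nonzero only if that bundle contains `e`, with total probability at most `∑ i, b i = 1` over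
  -- the agents, as the correlation gap requires.
  let X : M → ∀ i, Fin (k i) → ℝ := fun e i j => if e ∈ P i j then g i j e else 0
  have hX : ∀ e i j, 0 ≤ X e i j := fun e i j => by
    simp only [X]
    split_ifs
    exacts [hg0 i j e, le_rfl]
  have halloc : ∀ (ω : ∀ i, Fin (k i)) (e : M), ∃ i, ∀ j, X e j (ω j) ≤ X e i (ω i) := fun ω e =>
    Finite.exists_max fun i => X e i (ω i)
  choose alloc halloc using halloc
  have hgap : ∀ e, (1 - 1 / Real.exp 1) * ∑ i, ∑ j, w i j * X e i j ≤
      ∑ ω, (∏ i, w i (ω i)) * X e (alloc ω e) (ω (alloc ω e)) := by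
    intro e
    refine one_sub_inv_exp_mul_sum_le_sum_sup (fun i => (hP i).nonneg)
      (fun i => (hP i).sum_eq_one) (hX e) ?_ (fun ω i => halloc ω e i)
    rw [← hb1]
    refine Finset.sum_le_sum fun i _ => ?_
    rw [← (hP i).sum_item e]
    refine Finset.sum_le_sum_of_subset_of_nonneg (fun j hj => ?_) fun j _ _ => (hP i).nonneg j
    simp only [Finset.mem_filter, Finset.mem_univ, true_and, X] at hj ⊢
    by_contra hcon
    simp [hcon] at hj
  have hwel : ∀ ω, ∑ e, X e (alloc ω e) (ω (alloc ω e)) ≤ ∑ i, v i (bundle (alloc ω) i) := by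
    intro ω
    calc _ = ∑ i, ∑ e ∈ bundle (alloc ω) i, X e (alloc ω e) (ω (alloc ω e)) :=
          (Finset.sum_fiberwise _ _ _).symm
      _ ≤ ∑ i, ∑ e ∈ bundle (alloc ω) i, g i (ω i) e := by
          refine Finset.sum_le_sum fun i _ => Finset.sum_le_sum fun e he => ?_
          simp only [bundle, Finset.mem_filter, Finset.mem_univ, true_and] at he
          rw [he]
          simp only [X]
          split_ifs
          exacts [le_rfl, hg0 _ _ _]
      _ ≤ _ := Finset.sum_le_sum fun i _ => hgS _ _ _
  have hval : ∑ e, ∑ i, ∑ j, w i j * X e i j = ∑ i, ∑ j, w i j * v i (P i j) := by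
    rw [Finset.sum_comm]
    refine Finset.sum_congr rfl fun i _ => ?_
    rw [Finset.sum_comm]
    refine Finset.sum_congr rfl fun j _ => ?_
    rw [← Finset.mul_sum, hgP, Finset.sum_ite_mem, Finset.univ_inter]
  obtain ⟨a, ha⟩ := Finite.exists_max fun a : M → N => ∑ i, v i (bundle a i)
  refine ⟨a, ?_⟩
  have hsum : ∑ ω : ∀ i, Fin (k i), ∏ i, w i (ω i) = 1 := by
    rw [← Fintype.piFinset_univ, ← Finset.prod_univ_sum]
    exact Finset.prod_eq_one fun i _ => (hP i).sum_eq_one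
  calc _ = ∑ e, (1 - 1 / Real.exp 1) * ∑ i, ∑ j, w i j * X e i j := by
        rw [← hval, Finset.mul_sum]
    _ ≤ ∑ e, ∑ ω, (∏ i, w i (ω i)) * X e (alloc ω e) (ω (alloc ω e)) :=
        Finset.sum_le_sum fun e _ => hgap e
    _ = ∑ ω, (∏ i, w i (ω i)) * ∑ e, X e (alloc ω e) (ω (alloc ω e)) := by
        rw [Finset.sum_comm]
        simp_rw [Finset.mul_sum]
    _ ≤ ∑ ω : ∀ i, Fin (k i), (∏ i, w i (ω i)) * ∑ i, v i (bundle a i) :=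
        Finset.sum_le_sum fun ω _ => mul_le_mul_of_nonneg_left ((hwel ω).trans (ha _))
          (Finset.prod_nonneg fun i _ => (hP i).nonneg _)
    _ = _ := by rw [← Finset.sum_mul, hsum, one_mul]

theorem IsXOS.exists_one_sub_inv_exp_mes {N M : Type*} [Fintype N] [DecidableEq N] [Fintype M]
    [DecidableEq M] {b : N → ℝ} {v : N → Finset M → ℝ} (hb : ∀ i, 0 < b i) (hb1 : ∑ i, b i = 1)
    (hv : ∀ i, IsXOS (v i)) :
    ∃ p ∈ stdSimplex ℝ (M → N), ∀ i,
      (1 - 1 / Real.exp 1) * mes (v i) (b i) ≤ expectedValue p (v i) i := by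
  have he : 0 ≤ 1 - 1 / Real.exp 1 := by
    rw [sub_nonneg, one_div]
    exact inv_le_one_of_one_le₀ (Real.one_le_exp zero_le_one)
  refine exists_randomized_of_welfare he hb hb1 fun c hc x hx ε hε => ?_
  choose k P w hP hx using hx
  have hcv : ∀ i, IsXOS fun S => c i * v i S := by
    intro i
    obtain ⟨t, a, ha, hmax⟩ := (hv i).exists_max
    refine ⟨⟨by simp [(hv i).isValuation.normalized], fun S T h =>
      mul_le_mul_of_nonneg_left ((hv i).isValuation.monotone S T h) (hc i)⟩,
      t, fun j S => c i * a j S, fun j => ⟨⟨by simp [(ha j).1.normalized], fun S T h =>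
      mul_le_mul_of_nonneg_left ((ha j).1.monotone S T h) (hc i)⟩, fun S => ?_⟩, fun S => ?_⟩
    · exact (congrArg (c i * ·) ((ha j).2 S)).trans (Finset.mul_sum _ _ _)
    · obtain ⟨⟨j, hj⟩, hle⟩ := hmax S
      refine ⟨⟨j, congrArg (c i * ·) hj⟩, ?_⟩
      rintro _ ⟨j', rfl⟩
      exact mul_le_mul_of_nonneg_left (hle ⟨j', rfl⟩) (hc i)
  obtain ⟨a, ha⟩ := IsXOS.exists_welfare_ge hcv hb1 hP
  refine ⟨a, le_trans (sub_le_self _ hε.le) ?_⟩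
  simpa only [hx, Finset.mul_sum, mul_left_comm] using ha

/-! ### Tight instances on the cube -/

theorem not_exists_of_welfare_le {n m : ℕ} (hn : 0 < n) {v : Fin n → Finset (Fin m) → ℝ}
    {κ s : ℝ} (hκ : 0 ≤ κ) (hs : ∀ i, s ≤ mms (v i) n)
    (hw : ∀ a : Fin m → Fin n, ∑ i, v i (bundle a i) ≤ n * (κ * s)) :
    ¬ ∃ p ∈ stdSimplex ℝ (Fin m → Fin n), ∀ i, κ * mms (v i) n < expectedValue p (v i) i := by
  rintro ⟨p, hp, h⟩
  have : Nonempty (Fin n) := ⟨⟨0, hn⟩⟩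
  have h1 : ∑ _i : Fin n, κ * s < ∑ i, expectedValue p (v i) i :=
    Finset.sum_lt_sum_of_nonempty Finset.univ_nonempty fun i _ =>
      (mul_le_mul_of_nonneg_left (hs i) hκ).trans_lt (h i)
  have h2 : ∑ i, expectedValue p (v i) i ≤ n * (κ * s) := by
    simp only [expectedValue]
    rw [Finset.sum_comm]
    calc _ = ∑ a, p a * ∑ i, v i (bundle a i) := by simp_rw [Finset.mul_sum]
      _ ≤ ∑ a, p a * (n * (κ * s)) := Finset.sum_le_sum fun a _ =>
          mul_le_mul_of_nonneg_left (hw a) (hp.1 a)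
      _ = _ := by rw [← Finset.sum_mul, hp.2, one_mul]
  simp only [Finset.sum_const, Finset.card_univ, Fintype.card_fin, nsmul_eq_mul] at h1
  exact absurd h1 (not_lt.2 h2)

theorem le_mms {M : Type*} [Fintype M] {v : Finset M → ℝ} {n : ℕ} (hn : 0 < n) {s : ℝ}
    (a : M → Fin n) (h : ∀ j, s ≤ v (bundle a j)) : s ≤ mms v n := by
  have : Nonempty (Fin n) := ⟨⟨0, hn⟩⟩
  exact (le_ciInf h).trans ((mms_isGreatest v n hn).2 ⟨a, rfl⟩)

theorem mem_bundle {M N : Type*} [Fintype M] [DecidableEq N] {a : M → N} {i : N} {e : M} :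
    e ∈ bundle a i ↔ a e = i := by
  simp [bundle]

/-- The valuation that is `0` on the empty bundle, `2` on bundles that contain a part of the
partition `f`, and `1` otherwise. -/
noncomputable def coverValuation {M N : Type*} [Fintype M] [DecidableEq N] (f : M → N)
    (S : Finset M) : ℝ :=
  open Classical in if S = ∅ then 0 else if ∃ j, bundle f j ⊆ S then 2 else 1

/-- Nonempty bundles are worth between `1` and `2`, so two of them always pay for their union. -/
theorem coverValuation_isSubadditive {M N : Type*} [Fintype M] [DecidableEq M] [DecidableEq N]
    (f : M → N) : IsSubadditive (coverValuation f) := by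
  have h0 : coverValuation f ∅ = 0 := by simp [coverValuation]
  have hle : ∀ S, coverValuation f S ≤ 2 := fun S => by
    unfold coverValuation
    split_ifs <;> norm_num
  have hone : ∀ S, S ≠ ∅ → 1 ≤ coverValuation f S := fun S hS => by
    unfold coverValuation
    rw [if_neg hS]
    split_ifs <;> norm_num
  refine ⟨⟨h0, fun S T hST => ?_⟩, fun S T => ?_⟩
  · by_cases hS : S = ∅
    · rw [hS, h0]
      by_cases hT : T = ∅
      · rw [hT, h0]
      · exact zero_le_one.trans (hone T hT)
    · have hT : T ≠ ∅ := fun h => hS (Finset.subset_empty.1 (h ▸ hST))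
      by_cases hj : ∃ j, bundle f j ⊆ S
      · have hj' : ∃ j, bundle f j ⊆ T := hj.imp fun j h => h.trans hST
        simp [coverValuation, hS, hT, hj, hj']
      · refine le_trans (le_of_eq ?_) (hone T hT)
        simp [coverValuation, hS, hj]
  · by_cases hS : S = ∅
    · simp [hS, h0]
    · by_cases hT : T = ∅
      · simp [hT, h0]
      · linarith [hle (S ∪ T), hone S hS, hone T hT]

/-- The valuation whose value is the largest number of items in a common part of `f`. -/
noncomputable def largestPartValuation {M : Type*} [Fintype M] [DecidableEq M] {n : ℕ}
    (f : M → Fin n) (S : Finset M) : ℝ :=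
  ((Finset.univ.sup fun j => (S ∩ bundle f j).card : ℕ) : ℝ)

theorem exists_largestPartValuation_eq {M : Type*} [Fintype M] [DecidableEq M] {n : ℕ}
    (hn : 0 < n) (f : M → Fin n) (S : Finset M) :
    ∃ j, largestPartValuation f S = ((S ∩ bundle f j).card : ℝ) := by
  have : Nonempty (Fin n) := ⟨⟨0, hn⟩⟩
  obtain ⟨j, -, hj⟩ := Finset.exists_mem_eq_sup Finset.univ Finset.univ_nonempty
    fun j => (S ∩ bundle f j).card
  exact ⟨j, congrArg Nat.cast hj⟩

theorem card_inter_le_largestPartValuation {M : Type*} [Fintype M] [DecidableEq M] {n : ℕ}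
    (f : M → Fin n) (S : Finset M) (j : Fin n) :
    ((S ∩ bundle f j).card : ℝ) ≤ largestPartValuation f S :=
  Nat.cast_le.2 (Finset.le_sup (f := fun j => (S ∩ bundle f j).card) (Finset.mem_univ j))

theorem largestPartValuation_isXOS {M : Type*} [Fintype M] [DecidableEq M] {n : ℕ}
    (hn : 0 < n) (f : M → Fin n) : IsXOS (largestPartValuation f) := by
  have hmono : ∀ j : Fin n, ∀ S T : Finset M, S ⊆ T →
      ((S ∩ bundle f j).card : ℝ) ≤ ((T ∩ bundle f j).card : ℝ) := fun j S T h =>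
    Nat.cast_le.2 (Finset.card_le_card (Finset.inter_subset_inter_right h))
  refine ⟨⟨by simp [largestPartValuation], fun S T h => ?_⟩, n,
    fun j S => ((S ∩ bundle f j).card : ℝ), fun j => ⟨⟨by simp, hmono j⟩, fun S => ?_⟩,
    fun S => ⟨?_, ?_⟩⟩
  · obtain ⟨j, hj⟩ := exists_largestPartValuation_eq hn f S
    rw [hj]
    exact (hmono j S T h).trans (card_inter_le_largestPartValuation f T j)
  · have h1 : ∀ e, ((({e} : Finset M) ∩ bundle f j).card : ℝ) = if e ∈ bundle f j then 1 else 0 := by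
      intro e
      split_ifs with h
      · rw [Finset.singleton_inter_of_mem h, Finset.card_singleton, Nat.cast_one]
      · rw [Finset.singleton_inter_of_notMem h, Finset.card_empty, Nat.cast_zero]
    simp only [h1]
    rw [Finset.sum_ite_mem, Finset.sum_const, nsmul_eq_mul, mul_one]
  · obtain ⟨j, hj⟩ := exists_largestPartValuation_eq hn f S
    exact ⟨j, hj.symm⟩
  · rintro _ ⟨j, rfl⟩
    exact card_inter_le_largestPartValuation f S j

theorem card_filter_apply_eq (n : ℕ) (i j : Fin n) :
    (Finset.univ.filter fun x : Fin n → Fin n => x i = j).card = n ^ (n - 1) := by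
  have h : (Finset.univ.filter fun x : Fin n → Fin n => x i = j) =
      Fintype.piFinset (fun l => if l = i then {j} else Finset.univ) := by
    ext x
    simp only [Finset.mem_filter, Finset.mem_univ, true_and, Fintype.mem_piFinset]
    constructor
    · intro hx l
      split_ifs with hl
      · simp [hl, hx]
      · simp
    · intro hx
      simpa using hx i
  rw [h, Fintype.card_piFinset, ← Finset.mul_prod_erase _ _ (Finset.mem_univ i)]
  rw [Finset.prod_congr rfl (g := fun _ => n)]
  · simp
  · intro l hl
    simp [Finset.ne_of_mem_erase hl]

theorem card_filter_forall_ne (n : ℕ) (c : Fin n → Fin n) :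
    (Finset.univ.filter fun x : Fin n → Fin n => ∀ i, x i ≠ c i).card = (n - 1) ^ n := by
  have h : (Finset.univ.filter fun x : Fin n → Fin n => ∀ i, x i ≠ c i) =
      Fintype.piFinset (fun i => Finset.univ.erase (c i)) := by
    ext x
    simp
  rw [h, Fintype.card_piFinset]
  simp

/-- At most one agent can own a whole slice, so welfare is at most `n + 1`, against a maximin share
of at least `2` each. -/
theorem exists_subadditive_half_tight {ε : ℝ} (hε : 0 < ε) :
    ∃ (n m : ℕ) (v : Fin n → Finset (Fin m) → ℝ), 2 ≤ n ∧
      (∀ i, IsSubadditive (v i)) ∧ (∀ i, 0 < mms (v i) n) ∧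
      ¬ ∃ p ∈ stdSimplex ℝ (Fin m → Fin n), ∀ i,
        (1 / 2 + ε) * mms (v i) n < expectedValue p (v i) i := by
  obtain ⟨n₀, hn₀⟩ := exists_nat_gt (1 / (2 * ε))
  set n := n₀ + 2
  have hn : 0 < n := Nat.succ_pos _
  have hnε : 1 ≤ n * (2 * ε) := by
    rw [div_lt_iff₀ (by positivity)] at hn₀
    have : (n : ℝ) = n₀ + 2 := by simp [n]
    rw [this]
    nlinarith
  let φ : Fin (n ^ n) ≃ (Fin n → Fin n) := finFunctionFinEquiv.symm
  have hmms : ∀ i, 2 ≤ mms (coverValuation fun x => φ x i) n := by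
    intro i
    refine le_mms hn (fun x => φ x i) fun j => ?_
    have h1 : bundle (fun x => φ x i) j ≠ ∅ :=
      Finset.ne_empty_of_mem (a := φ.symm fun _ => j) (by simp [mem_bundle])
    have h2 : ∃ j', bundle (fun x => φ x i) j' ⊆ bundle (fun x => φ x i) j := ⟨j, subset_rfl⟩
    simp [coverValuation, h1, h2]
  refine ⟨n, n ^ n, fun i => coverValuation fun x => φ x i, Nat.le_add_left _ _,
    fun i => coverValuation_isSubadditive _, fun i => two_pos.trans_le (hmms i),
    not_exists_of_welfare_le hn (by positivity) hmms fun a => ?_⟩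
  have hle : ∀ i S, coverValuation (fun x => φ x i) S ≤
      1 + if ∃ j, bundle (fun x => φ x i) j ⊆ S then 1 else 0 := by
    intro i S
    unfold coverValuation
    split_ifs <;> norm_num
  have hcard : (Finset.univ.filter fun i =>
      ∃ j, bundle (fun x => φ x i) j ⊆ bundle a i).card ≤ 1 := by
    rw [Finset.card_le_one]
    intro i hi i' hi'
    simp only [Finset.mem_filter, Finset.mem_univ, true_and] at hi hi'
    obtain ⟨j, hj⟩ := hi
    obtain ⟨j', hj'⟩ := hi'
    by_contra hne
    -- This point lies in both slices, so it would belong to two agents.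
    have h1 := mem_bundle.1 (@hj (φ.symm (Function.update (fun _ => j) i' j')) (by
      simp [mem_bundle, Function.update_of_ne hne]))
    have h2 := mem_bundle.1 (@hj' (φ.symm (Function.update (fun _ => j) i' j')) (by
      simp [mem_bundle]))
    exact hne (h1.symm.trans h2)
  calc _ ≤ ∑ i, (1 + if ∃ j, bundle (fun x => φ x i) j ⊆ bundle a i then (1 : ℝ) else 0) :=
        Finset.sum_le_sum fun i _ => hle i _
    _ ≤ n + 1 := by
        rw [Finset.sum_add_distrib, Finset.sum_boole]
        simp only [Finset.sum_const, Finset.card_univ, Fintype.card_fin, nsmul_eq_mul, mul_one]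
        exact add_le_add_right (by exact_mod_cast hcard) _
    _ ≤ _ := by linarith

/-- Each agent's value counts items in a single slice `c i`. The `(n - 1) ^ n` points avoiding all
these slices count for nobody, so welfare is at most `n ^ n - (n - 1) ^ n`. Dividing by `n * n ^ (n
- 1)` gives `1 - (1 - 1 / n) ^ n`, which tends to `1 - 1 / e`. -/
theorem exists_xos_one_sub_inv_exp_tight {ε : ℝ} (hε : 0 < ε) :
    ∃ (n m : ℕ) (v : Fin n → Finset (Fin m) → ℝ), 2 ≤ n ∧
      (∀ i, IsXOS (v i)) ∧ (∀ i, 0 < mms (v i) n) ∧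
      ¬ ∃ p ∈ stdSimplex ℝ (Fin m → Fin n), ∀ i,
        (1 - 1 / Real.exp 1 + ε) * mms (v i) n < expectedValue p (v i) i := by
  have hlim : ∀ᶠ n : ℕ in Filter.atTop, 1 / Real.exp 1 - ε < (1 + (-1) / (n : ℝ)) ^ n := by
    refine (Real.tendsto_one_add_div_pow_exp (-1)).eventually_const_lt ?_
    rw [Real.exp_neg, one_div]
    linarith
  obtain ⟨n, hnlim, hn2⟩ := (hlim.and (Filter.eventually_ge_atTop 2)).exists
  have hn : 0 < n := two_pos.trans_le hn2
  have hn0 : (n : ℝ) ≠ 0 := by positivity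
  let φ : Fin (n ^ n) ≃ (Fin n → Fin n) := finFunctionFinEquiv.symm
  have hmms : ∀ i, (n : ℝ) ^ (n - 1) ≤ mms (largestPartValuation fun x => φ x i) n := by
    intro i
    refine le_mms hn (fun x => φ x i) fun j => ?_
    refine le_trans (le_of_eq ?_) (card_inter_le_largestPartValuation (fun x => φ x i) _ j)
    rw [Finset.inter_self, ← Nat.cast_pow, ← card_filter_apply_eq n i j, bundle]
    congr 1
    refine (Finset.card_equiv φ fun x => ?_).symm
    simp
  have he : 0 ≤ 1 - 1 / Real.exp 1 := by
    rw [sub_nonneg, one_div]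
    exact inv_le_one_of_one_le₀ (Real.one_le_exp zero_le_one)
  refine ⟨n, n ^ n, fun i => largestPartValuation fun x => φ x i, hn2,
    fun i => largestPartValuation_isXOS hn _, fun i => lt_of_lt_of_le (by positivity) (hmms i),
    not_exists_of_welfare_le hn (by positivity) hmms fun a => ?_⟩
  choose c hc using fun i => exists_largestPartValuation_eq hn (fun x => φ x i) (bundle a i)
  have hcover : ∑ i, (bundle a i ∩ bundle (fun x => φ x i) (c i)).card +
      (Finset.univ.filter fun x : Fin n → Fin n => ∀ i, x i ≠ c i).card ≤ n ^ n := by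
    rw [← Finset.card_biUnion]
    · rw [← Finset.card_equiv (s := Finset.univ.filter fun x => ∀ i, φ x i ≠ c i) φ (by simp),
        ← Finset.card_union_of_disjoint]
      · exact (Finset.card_le_univ _).trans (by simp)
      · rw [Finset.disjoint_left]
        intro x hx
        simp only [Finset.mem_biUnion, Finset.mem_inter, mem_bundle] at hx
        obtain ⟨i, -, -, hi⟩ := hx
        simp only [Finset.mem_filter, Finset.mem_univ, true_and, not_forall, not_not]
        exact ⟨i, hi⟩
    · intro i _ i' _ hne
      refine Finset.disjoint_left.2 fun x hx hx' => hne ?_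
      rw [Finset.mem_inter, mem_bundle] at hx hx'
      exact hx.1.symm.trans hx'.1
  rw [card_filter_forall_ne] at hcover
  have hcover' : ∑ i, largestPartValuation (fun x => φ x i) (bundle a i) + ((n : ℝ) - 1) ^ n ≤
      (n : ℝ) ^ n := by
    simp_rw [hc]
    rw [← Nat.cast_one, ← Nat.cast_sub hn]
    exact_mod_cast hcover
  have hpow : ((n : ℝ) - 1) ^ n = (n : ℝ) ^ n * (1 + (-1) / (n : ℝ)) ^ n := by
    rw [← mul_pow]
    congr 1
    field_simp
    ring
  have hnn : (n : ℝ) * (n : ℝ) ^ (n - 1) = (n : ℝ) ^ n := mul_pow_sub_one hn.ne' _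
  have h1 : (n : ℝ) * ((1 - 1 / Real.exp 1 + ε) * (n : ℝ) ^ (n - 1)) =
      (1 - 1 / Real.exp 1 + ε) * (n : ℝ) ^ n := by
    rw [← hnn]
    ring
  rw [h1]
  have h2 : (n : ℝ) ^ n * (1 / Real.exp 1 - ε) ≤ (n : ℝ) ^ n * (1 + (-1) / (n : ℝ)) ^ n :=
    mul_le_mul_of_nonneg_left hnlim.le (by positivity)
  linarith

end FairDivision

theorem mainTheorem4 :
    -- subadditive valuations, arbitrary entitlements
    (∀ (N M : Type*) [Fintype N] [DecidableEq N] [Fintype M] [DecidableEq M]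
      (b : N → ℝ) (v : N → Finset M → ℝ),
      (∀ i, 0 < b i) → ∑ i, b i = 1 → (∀ i, FairDivision.IsSubadditive (v i)) →
      ∃ p ∈ stdSimplex ℝ (M → N), ∀ i,
        1 / 2 * FairDivision.mes (v i) (b i) ≤ FairDivision.expectedValue p (v i) i) ∧
    -- subadditive valuations, tightness with equal entitlements
    (∀ ε : ℝ, 0 < ε → ∃ (n m : ℕ) (v : Fin n → Finset (Fin m) → ℝ), 2 ≤ n ∧
      (∀ i, FairDivision.IsSubadditive (v i)) ∧ (∀ i, 0 < FairDivision.mms (v i) n) ∧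
      ¬ ∃ p ∈ stdSimplex ℝ (Fin m → Fin n), ∀ i,
        (1 / 2 + ε) * FairDivision.mms (v i) n < FairDivision.expectedValue p (v i) i) ∧
    -- XOS valuations, arbitrary entitlements
    (∀ (N M : Type*) [Fintype N] [DecidableEq N] [Fintype M] [DecidableEq M]
      (b : N → ℝ) (v : N → Finset M → ℝ),
      (∀ i, 0 < b i) → ∑ i, b i = 1 → (∀ i, FairDivision.IsXOS (v i)) →
      ∃ p ∈ stdSimplex ℝ (M → N), ∀ i,
        (1 - 1 / Real.exp 1) * FairDivision.mes (v i) (b i) ≤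
          FairDivision.expectedValue p (v i) i) ∧
    -- XOS valuations, tightness with equal entitlements
    (∀ ε : ℝ, 0 < ε → ∃ (n m : ℕ) (v : Fin n → Finset (Fin m) → ℝ), 2 ≤ n ∧
      (∀ i, FairDivision.IsXOS (v i)) ∧ (∀ i, 0 < FairDivision.mms (v i) n) ∧
      ¬ ∃ p ∈ stdSimplex ℝ (Fin m → Fin n), ∀ i,
        (1 - 1 / Real.exp 1 + ε) * FairDivision.mms (v i) n <
          FairDivision.expectedValue p (v i) i) :=
  ⟨fun _ _ _ _ _ _ _ _ hb hb1 hv => FairDivision.IsSubadditive.exists_half_mes hb hb1 hv,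
    fun _ hε => FairDivision.exists_subadditive_half_tight hε,
    fun _ _ _ _ _ _ _ _ hb hb1 hv => FairDivision.IsXOS.exists_one_sub_inv_exp_mes hb hb1 hv,
    fun _ hε => FairDivision.exists_xos_one_sub_inv_exp_tight hε⟩
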